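/- Let $k,m,n$ be natural numbers, let $L$ be a self-adjoint complex $n\times n$ matrix, and let $H_1,\dots,H_k$ be complex $m\times n$ matrices with $$H_1^*H_1+\cdots+H_k^*H_k\le I_n,$$ where $\le$ is the Loewner order ($X\le Y$ means that $Y-X$ is positive semidefinite) and $I_n$ is the $n\times n$ unit matrix. Then the real-valued trace function $$\varphi(A_1,\dots,A_k)=\operatorname{Tr}\exp\bigl(L+H_1^*\log(A_1)H_1+\cdots+H_k^*\log(A_k)H_k\bigr)$$ is jointly concave on the convex set of $k$-tuples $(A_1,\dots,A_k)$ of positive definite complex $m\times m$ matrices; that is, for all such tuples $A,B$ and all $t\in[0,1]$, $$\varphi\bigl(tA+(1-t)B\bigr)\ge t\,\varphi(A)+(1-t)\,\varphi(B).$$ -/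

import Mathlib

open scoped Matrix ComplexOrder MatrixOrder

/-- The matrix `L + ∑ i, Hᵢ* log(Aᵢ) Hᵢ`. The logarithm of a self-adjoint matrix is given by the
functional calculus; in the theorem it is taken of positive definite matrices only. -/
noncomputable def lsExponent {k m n : ℕ} (L : Matrix (Fin n) (Fin n) ℂ)
    (H : Fin k → Matrix (Fin m) (Fin n) ℂ) (A : Fin k → Matrix (Fin m) (Fin m) ℂ) :
    Matrix (Fin n) (Fin n) ℂ :=
  L + ∑ i, (H i)ᴴ * cfc Real.log (A i) * H i

/-- The trace function `φ(A₁, …, Aₖ) = Tr exp (L + ∑ i, Hᵢ* log(Aᵢ) Hᵢ)` as a real number.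
For self-adjoint `L` the trace is real, see `ofReal_lsTrace`. -/
noncomputable def lsTrace {k m n : ℕ} (L : Matrix (Fin n) (Fin n) ℂ)
    (H : Fin k → Matrix (Fin m) (Fin n) ℂ) (A : Fin k → Matrix (Fin m) (Fin m) ℂ) : ℝ :=
  (NormedSpace.exp (lsExponent L H A)).trace.re

/-- Taking the real part in `lsTrace` loses nothing. -/
theorem ofReal_lsTrace {k m n : ℕ} {L : Matrix (Fin n) (Fin n) ℂ} (hL : L.IsHermitian)
    (H : Fin k → Matrix (Fin m) (Fin n) ℂ) (A : Fin k → Matrix (Fin m) (Fin m) ℂ) :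
    (lsTrace L H A : ℂ) = (NormedSpace.exp (lsExponent L H A)).trace := by
  have h1 : (lsExponent L H A).IsHermitian := by
    refine hL.add ?_
    refine isSelfAdjoint_sum _ fun i _ => ?_
    have h : (cfc Real.log (A i)).IsHermitian := cfc_predicate Real.log (A i)
    exact Matrix.isHermitian_conjTranspose_mul_mul (H i) h
  have h2 : star (NormedSpace.exp (lsExponent L H A)).trace
      = (NormedSpace.exp (lsExponent L H A)).trace := by
    rw [← Matrix.trace_conjTranspose, h1.exp.eq]
  exact Complex.conj_eq_iff_re.mp h2

/-! The Gibbs variational principle gives `Tr exp K = max_T (Tr KT - Tr T log T + Tr T)` over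
positive definite `T` (`gibbs_le`, `gibbs_exp`). A partial maximum of a jointly concave function is
concave, so joint concavity in `(A, T)` for `K = lsExponent L H A` suffices. Writing `1 - ∑ Hᵢ* Hᵢ =
R* R`, the functional is linear in `T` minus twisted relative entropies (`gibbs_lsExponent_eq`).
Each entropy is jointly convex: up to a linear term it is an integral over `s ∈ [0, 1]` of quadratic
perspectives with weight `1 - s`, and each perspective is a maximum of functions affine in `(A, T)`.
-/

open Matrix

/-! ### Joint convexity of the twisted relative entropy -/

section RelativeEntropy

variable {m n : Type*} [Fintype m] [DecidableEq m] [Fintype n] [DecidableEq n]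

/-- The matrix of `X` with respect to eigenbases of `A` and `T`. -/
noncomputable def eigenCoord {A : Matrix m m ℂ} {T : Matrix n n ℂ} (hA : A.IsHermitian)
    (hT : T.IsHermitian) (X : Matrix m n ℂ) : Matrix m n ℂ :=
  (hA.eigenvectorUnitary : Matrix m m ℂ)ᴴ * X * (hT.eigenvectorUnitary : Matrix n n ℂ)

theorem eigenCoord_surjective {A : Matrix m m ℂ} {T : Matrix n n ℂ} (hA : A.IsHermitian)
    (hT : T.IsHermitian) : Function.Surjective (eigenCoord hA hT) := by
  intro Z
  refine ⟨(hA.eigenvectorUnitary : Matrix m m ℂ) * Z * (hT.eigenvectorUnitary : Matrix n n ℂ)ᴴ, ?_⟩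
  have h1 : (hA.eigenvectorUnitary : Matrix m m ℂ)ᴴ * (hA.eigenvectorUnitary : Matrix m m ℂ) = 1 :=
    Unitary.coe_star_mul_self hA.eigenvectorUnitary
  have h2 : (hT.eigenvectorUnitary : Matrix n n ℂ)ᴴ * (hT.eigenvectorUnitary : Matrix n n ℂ) = 1 :=
    Unitary.coe_star_mul_self hT.eigenvectorUnitary
  simp only [eigenCoord, Matrix.mul_assoc, h2, Matrix.mul_one]
  rw [← Matrix.mul_assoc, h1, Matrix.one_mul]

/-- Left multiplication by `f(A)` and right multiplication by `g(T)` commute and are both diagonal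
in the eigenbases, so trace identities reduce to scalar ones. -/
theorem re_trace_cfc_mul_cfc {A : Matrix m m ℂ} {T : Matrix n n ℂ} (hA : A.IsHermitian)
    (hT : T.IsHermitian) (X Y : Matrix m n ℂ) (f g : ℝ → ℝ) :
    (Yᴴ * cfc f A * X * cfc g T).trace.re =
      ∑ i, ∑ j, f (hA.eigenvalues i) * g (hT.eigenvalues j) *
        (star (eigenCoord hA hT Y i j) * eigenCoord hA hT X i j).re := by
  set U := (hA.eigenvectorUnitary : Matrix m m ℂ) with hU
  set V := (hT.eigenvectorUnitary : Matrix n n ℂ) with hV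
  have h : (Yᴴ * cfc f A * X * cfc g T).trace =
      ((eigenCoord hA hT Y)ᴴ * diagonal (fun i => (f (hA.eigenvalues i) : ℂ)) *
        eigenCoord hA hT X * diagonal (fun j => (g (hT.eigenvalues j) : ℂ))).trace := by
    rw [hA.cfc_eq, hT.cfc_eq, IsHermitian.cfc, IsHermitian.cfc, Unitary.conjStarAlgAut_apply,
      Unitary.conjStarAlgAut_apply, ← hU, ← hV]
    simp only [eigenCoord, ← hU, ← hV, conjTranspose_mul, conjTranspose_conjTranspose,
      star_eq_conjTranspose, Function.comp_def]
    rw [← Matrix.mul_assoc, ← Matrix.mul_assoc (_ * X), Matrix.trace_mul_comm]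
    simp only [Matrix.mul_assoc]
    rfl
  rw [h, Finset.sum_comm]
  simp only [Matrix.trace, Matrix.diag_apply, Complex.re_sum, Matrix.mul_diagonal]
  refine Finset.sum_congr rfl fun j _ => ?_
  rw [Matrix.mul_apply, Finset.sum_mul, Complex.re_sum]
  refine Finset.sum_congr rfl fun i _ => ?_
  rw [Matrix.mul_diagonal, conjTranspose_apply]
  rw [show star (eigenCoord hA hT Y i j) * (f (hA.eigenvalues i) : ℂ) * eigenCoord hA hT X i j *
      (g (hT.eigenvalues j) : ℂ) = ((f (hA.eigenvalues i) * g (hT.eigenvalues j) : ℝ) : ℂ) *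
        (star (eigenCoord hA hT Y i j) * eigenCoord hA hT X i j) by push_cast; ring,
    Complex.re_ofReal_mul]

theorem re_trace_mul_cfc {A : Matrix m m ℂ} {T : Matrix n n ℂ} (hA : A.IsHermitian)
    (hT : T.IsHermitian) (X Y : Matrix m n ℂ) (g : ℝ → ℝ) :
    (Yᴴ * X * cfc g T).trace.re =
      ∑ i, ∑ j, g (hT.eigenvalues j) *
        (star (eigenCoord hA hT Y i j) * eigenCoord hA hT X i j).re := by
  have h := re_trace_cfc_mul_cfc hA hT X Y (fun _ => 1) g
  rw [cfc_const_one ℝ A hA.isSelfAdjoint] at h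
  simpa using h

theorem re_trace_cfc_mul {A : Matrix m m ℂ} {T : Matrix n n ℂ} (hA : A.IsHermitian)
    (hT : T.IsHermitian) (X Y : Matrix m n ℂ) (f : ℝ → ℝ) :
    (Yᴴ * cfc f A * X).trace.re =
      ∑ i, ∑ j, f (hA.eigenvalues i) *
        (star (eigenCoord hA hT Y i j) * eigenCoord hA hT X i j).re := by
  have h := re_trace_cfc_mul_cfc hA hT X Y f (fun _ => 1)
  rw [cfc_const_one ℝ T hT.isSelfAdjoint] at h
  simpa using h

/-- An affine minorant of the quadratic perspective, as a function of `(A, T)`. -/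
noncomputable def affineMinorant (s : ℝ) (H Y : Matrix m n ℂ) (A : Matrix m m ℂ)
    (T : Matrix n n ℂ) : ℝ :=
  2 * (Yᴴ * H * T).trace.re - 2 * (Yᴴ * A * H).trace.re
    - (1 - s) * (Yᴴ * A * Y).trace.re - s * (Yᴴ * Y * T).trace.re

/-- The quadratic form of the inverse of `(1 - s) L_A + s R_T` at `H * T - A * H`, in
eigenbases. -/
noncomputable def quadPerspective (s : ℝ) (H : Matrix m n ℂ) {A : Matrix m m ℂ}
    {T : Matrix n n ℂ} (hA : A.IsHermitian) (hT : T.IsHermitian) : ℝ :=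
  ∑ i, ∑ j, Complex.normSq (eigenCoord hA hT H i j) *
    ((hT.eigenvalues j - hA.eigenvalues i) ^ 2 /
      ((1 - s) * hA.eigenvalues i + s * hT.eigenvalues j))

theorem affineMinorant_eq_sum (s : ℝ) (H Y : Matrix m n ℂ) {A : Matrix m m ℂ}
    {T : Matrix n n ℂ} (hA : A.IsHermitian) (hT : T.IsHermitian) :
    affineMinorant s H Y A T = ∑ i, ∑ j,
      (2 * (hT.eigenvalues j - hA.eigenvalues i) *
        (star (eigenCoord hA hT Y i j) * eigenCoord hA hT H i j).re -
      ((1 - s) * hA.eigenvalues i + s * hT.eigenvalues j) *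
        Complex.normSq (eigenCoord hA hT Y i j)) := by
  have hidA : cfc (fun x : ℝ => x) A = A := cfc_id' ℝ A hA
  have hidT : cfc (fun x : ℝ => x) T = T := cfc_id' ℝ T hT
  have e1 := re_trace_mul_cfc hA hT H Y (fun x => x)
  have e2 := re_trace_cfc_mul hA hT H Y (fun x => x)
  have e3 := re_trace_cfc_mul hA hT Y Y (fun x => x)
  have e4 := re_trace_mul_cfc hA hT Y Y (fun x => x)
  rw [hidT] at e1 e4
  rw [hidA] at e2 e3
  rw [affineMinorant, e1, e2, e3, e4]
  simp only [Finset.mul_sum, ← Finset.sum_sub_distrib]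
  refine Finset.sum_congr rfl fun i _ => Finset.sum_congr rfl fun j _ => ?_
  simp only [Complex.normSq_apply, Complex.star_def, Complex.mul_re, Complex.conj_re,
    Complex.conj_im]
  ring

theorem convexComb_pos {a b s : ℝ} (ha : 0 < a) (hb : 0 < b) (hs : s ∈ Set.Icc (0 : ℝ) 1) :
    0 < (1 - s) * a + s * b := by
  rcases hs.1.eq_or_lt with h | h
  · simpa [← h] using ha
  · have := mul_pos h hb
    have := mul_nonneg (sub_nonneg.2 hs.2) ha.le
    linarith

theorem affineMinorant_le_quadPerspective {s : ℝ} (hs : s ∈ Set.Icc (0 : ℝ) 1)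
    (H Y : Matrix m n ℂ) {A : Matrix m m ℂ} {T : Matrix n n ℂ} (hA : A.PosDef) (hT : T.PosDef) :
    affineMinorant s H Y A T ≤ quadPerspective s H hA.1 hT.1 := by
  rw [affineMinorant_eq_sum s H Y hA.1 hT.1, quadPerspective]
  refine Finset.sum_le_sum fun i _ => Finset.sum_le_sum fun j _ => ?_
  have hd := convexComb_pos (hA.eigenvalues_pos i) (hT.eigenvalues_pos j) hs
  set d := (1 - s) * hA.1.eigenvalues i + s * hT.1.eigenvalues j
  set r := hT.1.eigenvalues j - hA.1.eigenvalues i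
  rw [← mul_div_assoc, le_div_iff₀ hd]
  simp only [Complex.normSq_apply, Complex.star_def, Complex.mul_re, Complex.conj_re,
    Complex.conj_im]
  set w := eigenCoord hA.1 hT.1 H i j
  set y := eigenCoord hA.1 hT.1 Y i j
  -- Completing the square: `2 r Re(ȳw) - d|y|² ≤ r²|w|²/d`, with equality at `y = (r/d) w`.
  nlinarith [sq_nonneg (d * y.re - r * w.re), sq_nonneg (d * y.im - r * w.im)]

theorem exists_affineMinorant_eq {s : ℝ} (hs : s ∈ Set.Icc (0 : ℝ) 1)
    (H : Matrix m n ℂ) {A : Matrix m m ℂ} {T : Matrix n n ℂ} (hA : A.PosDef) (hT : T.PosDef) :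
    ∃ Y, affineMinorant s H Y A T = quadPerspective s H hA.1 hT.1 := by
  -- The maximizer of the completed square in every entry.
  obtain ⟨Y, hY⟩ := eigenCoord_surjective hA.1 hT.1 (fun i j =>
    (((hT.1.eigenvalues j - hA.1.eigenvalues i) /
      ((1 - s) * hA.1.eigenvalues i + s * hT.1.eigenvalues j) : ℝ) : ℂ) *
        eigenCoord hA.1 hT.1 H i j)
  refine ⟨Y, ?_⟩
  rw [affineMinorant_eq_sum s H Y hA.1 hT.1, quadPerspective, hY]
  refine Finset.sum_congr rfl fun i _ => Finset.sum_congr rfl fun j _ => ?_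
  have hd := convexComb_pos (hA.eigenvalues_pos i) (hT.eigenvalues_pos j) hs
  simp only
  set d := (1 - s) * hA.1.eigenvalues i + s * hT.1.eigenvalues j
  set r := hT.1.eigenvalues j - hA.1.eigenvalues i
  simp only [Complex.normSq_apply, Complex.star_def, Complex.mul_re, Complex.conj_re,
    Complex.conj_im, Complex.mul_im, Complex.ofReal_re, Complex.ofReal_im]
  field_simp
  ring

theorem posDef_convexComb {ι : Type*} [Fintype ι] {A B : Matrix ι ι ℂ} (hA : A.PosDef)
    (hB : B.PosDef) {x y : ℝ} (hx : 0 ≤ x) (hy : 0 ≤ y) (hxy : x + y = 1) :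
    (x • A + y • B).PosDef := by
  rcases hx.eq_or_lt with h | h
  · obtain rfl : y = 1 := by linarith
    simpa [← h] using hB
  · exact (hA.smul h).add_posSemidef (hB.posSemidef.smul hy)

omit [DecidableEq m] [DecidableEq n] in
theorem affineMinorant_convexComb (s : ℝ) (H Y : Matrix m n ℂ) (A B : Matrix m m ℂ)
    (T S : Matrix n n ℂ) (x y : ℝ) :
    affineMinorant s H Y (x • A + y • B) (x • T + y • S) =
      x * affineMinorant s H Y A T + y * affineMinorant s H Y B S := by
  simp only [affineMinorant, Matrix.mul_add, Matrix.add_mul, Matrix.mul_smul, Matrix.smul_mul,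
    Matrix.trace_add, Matrix.trace_smul, Complex.add_re, Complex.smul_re, smul_eq_mul]
  ring

/-- The minorant that is exact at the convex combination is affine in `(A, T)` and lies below the
perspective at both endpoints. -/
theorem quadPerspective_convexComb_le {s : ℝ} (hs : s ∈ Set.Icc (0 : ℝ) 1) (H : Matrix m n ℂ)
    {A B : Matrix m m ℂ} {T S : Matrix n n ℂ} (hA : A.PosDef) (hB : B.PosDef) (hT : T.PosDef)
    (hS : S.PosDef) {x y : ℝ} (hx : 0 ≤ x) (hy : 0 ≤ y) (hxy : x + y = 1) :
    quadPerspective s H (posDef_convexComb hA hB hx hy hxy).1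
        (posDef_convexComb hT hS hx hy hxy).1 ≤
      x * quadPerspective s H hA.1 hT.1 + y * quadPerspective s H hB.1 hS.1 := by
  obtain ⟨Y, hY⟩ := exists_affineMinorant_eq hs H (posDef_convexComb hA hB hx hy hxy)
    (posDef_convexComb hT hS hx hy hxy)
  rw [← hY, affineMinorant_convexComb]
  have h1 := affineMinorant_le_quadPerspective hs H Y hA hT
  have h2 := affineMinorant_le_quadPerspective hs H Y hB hS
  gcongr

theorem continuousOn_sq_div_convexComb {a t : ℝ} (ha : 0 < a) (ht : 0 < t) :
    ContinuousOn (fun s : ℝ => (1 - s) * ((t - a) ^ 2 / ((1 - s) * a + s * t)))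
      (Set.Icc 0 1) := by
  refine ContinuousOn.mul (by fun_prop) (ContinuousOn.div (by fun_prop) (by fun_prop) ?_)
  exact fun s hs => (convexComb_pos ha ht hs).ne'

theorem intervalIntegrable_sq_div_convexComb {a t : ℝ} (ha : 0 < a) (ht : 0 < t) :
    IntervalIntegrable (fun s : ℝ => (1 - s) * ((t - a) ^ 2 / ((1 - s) * a + s * t)))
      MeasureTheory.volume 0 1 :=
  ContinuousOn.intervalIntegrable
    (by rw [Set.uIcc_of_le zero_le_one]; exact continuousOn_sq_div_convexComb ha ht)

/-- This is the second-order Taylor remainder of `x log x`, expanded at `a` and evaluated at `t`. -/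
theorem integral_sq_div_convexComb {a t : ℝ} (ha : 0 < a) (ht : 0 < t) :
    ∫ s in (0 : ℝ)..1, (1 - s) * ((t - a) ^ 2 / ((1 - s) * a + s * t)) =
      t * (Real.log t - Real.log a) - t + a := by
  have hderiv : ∀ s ∈ Set.uIcc (0 : ℝ) 1, HasDerivAt
      (fun s : ℝ => t * Real.log ((1 - s) * a + s * t) + s * (a - t))
      ((1 - s) * ((t - a) ^ 2 / ((1 - s) * a + s * t))) s := by
    intro s hs
    rw [Set.uIcc_of_le zero_le_one] at hs
    have hd := convexComb_pos ha ht hs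
    have h1 : HasDerivAt (fun s : ℝ => (1 - s) * a + s * t) ((-1) * a + 1 * t) s :=
      (((hasDerivAt_id s).const_sub 1).mul_const a).add ((hasDerivAt_id s).mul_const t)
    have h2 := ((h1.log hd.ne').const_mul t).add ((hasDerivAt_id s).mul_const (a - t))
    refine h2.congr_deriv ?_
    rw [← mul_div_assoc, ← mul_div_assoc, div_add' _ _ _ hd.ne']
    congr 1
    ring
  rw [intervalIntegral.integral_eq_sub_of_hasDerivAt hderiv
    (intervalIntegrable_sq_div_convexComb ha ht)]
  simp
  ring

/-- Lindblad's form of the relative entropy of `T` and `A`, twisted by `H`. -/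
noncomputable def twistedRelEntropy (H : Matrix m n ℂ) (A : Matrix m m ℂ) (T : Matrix n n ℂ) : ℝ :=
  (Hᴴ * H * cfc (fun x => x * Real.log x) T).trace.re - (Hᴴ * cfc Real.log A * H * T).trace.re

theorem twistedRelEntropy_eq_sum (H : Matrix m n ℂ) {A : Matrix m m ℂ} {T : Matrix n n ℂ}
    (hA : A.IsHermitian) (hT : T.IsHermitian) :
    twistedRelEntropy H A T = (Hᴴ * H * T).trace.re - (Hᴴ * A * H).trace.re +
      ∑ i, ∑ j, Complex.normSq (eigenCoord hA hT H i j) *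
        (hT.eigenvalues j * (Real.log (hT.eigenvalues j) - Real.log (hA.eigenvalues i)) -
          hT.eigenvalues j + hA.eigenvalues i) := by
  have hidA : cfc (fun x : ℝ => x) A = A := cfc_id' ℝ A hA
  have hidT : cfc (fun x : ℝ => x) T = T := cfc_id' ℝ T hT
  have e1 := re_trace_mul_cfc hA hT H H (fun x => x)
  have e2 := re_trace_cfc_mul hA hT H H (fun x => x)
  have e3 := re_trace_mul_cfc hA hT H H (fun x => x * Real.log x)
  have e4 := re_trace_cfc_mul_cfc hA hT H H Real.log (fun x => x)
  rw [hidT] at e1 e4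
  rw [hidA] at e2
  rw [twistedRelEntropy, e1, e2, e3, e4]
  simp only [← Finset.sum_sub_distrib, ← Finset.sum_add_distrib]
  refine Finset.sum_congr rfl fun i _ => Finset.sum_congr rfl fun j _ => ?_
  simp only [Complex.normSq_apply, Complex.star_def, Complex.mul_re, Complex.conj_re,
    Complex.conj_im]
  ring

theorem one_sub_mul_quadPerspective (s : ℝ) (H : Matrix m n ℂ) {A : Matrix m m ℂ}
    {T : Matrix n n ℂ} (hA : A.IsHermitian) (hT : T.IsHermitian) :
    (1 - s) * quadPerspective s H hA hT = ∑ i, ∑ j, Complex.normSq (eigenCoord hA hT H i j) *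
      ((1 - s) * ((hT.eigenvalues j - hA.eigenvalues i) ^ 2 /
        ((1 - s) * hA.eigenvalues i + s * hT.eigenvalues j))) := by
  simp only [quadPerspective, Finset.mul_sum]
  exact Finset.sum_congr rfl fun i _ => Finset.sum_congr rfl fun j _ => mul_left_comm _ _ _

theorem intervalIntegrable_quadPerspective (H : Matrix m n ℂ) {A : Matrix m m ℂ}
    {T : Matrix n n ℂ} (hA : A.PosDef) (hT : T.PosDef) :
    IntervalIntegrable (fun s => (1 - s) * quadPerspective s H hA.1 hT.1)
      MeasureTheory.volume 0 1 := by
  simp only [one_sub_mul_quadPerspective]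
  refine ContinuousOn.intervalIntegrable (continuousOn_finsetSum _ fun i _ =>
    continuousOn_finsetSum _ fun j _ => continuousOn_const.mul ?_)
  rw [Set.uIcc_of_le zero_le_one]
  exact continuousOn_sq_div_convexComb (hA.eigenvalues_pos i) (hT.eigenvalues_pos j)

theorem twistedRelEntropy_eq_integral (H : Matrix m n ℂ) {A : Matrix m m ℂ} {T : Matrix n n ℂ}
    (hA : A.PosDef) (hT : T.PosDef) :
    twistedRelEntropy H A T = (Hᴴ * H * T).trace.re - (Hᴴ * A * H).trace.re +
      ∫ s in (0 : ℝ)..1, (1 - s) * quadPerspective s H hA.1 hT.1 := by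
  have hint := fun i j => (intervalIntegrable_sq_div_convexComb (hA.eigenvalues_pos i)
    (hT.eigenvalues_pos j)).const_mul (Complex.normSq (eigenCoord hA.1 hT.1 H i j))
  rw [twistedRelEntropy_eq_sum H hA.1 hT.1]
  simp only [one_sub_mul_quadPerspective]
  congr 1
  rw [intervalIntegral.integral_finsetSum fun i _ => by
    simpa only [Finset.sum_fn] using IntervalIntegrable.sum Finset.univ fun j _ => hint i j]
  refine Finset.sum_congr rfl fun i _ => ?_
  rw [intervalIntegral.integral_finsetSum fun j _ => hint i j]
  refine Finset.sum_congr rfl fun j _ => ?_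
  rw [intervalIntegral.integral_const_mul,
    integral_sq_div_convexComb (hA.eigenvalues_pos i) (hT.eigenvalues_pos j)]

/-- Joint convexity of the twisted relative entropy. -/
theorem twistedRelEntropy_convexComb_le (H : Matrix m n ℂ)
    {A B : Matrix m m ℂ} {T S : Matrix n n ℂ} (hA : A.PosDef) (hB : B.PosDef) (hT : T.PosDef)
    (hS : S.PosDef) {x y : ℝ} (hx : 0 ≤ x) (hy : 0 ≤ y) (hxy : x + y = 1) :
    twistedRelEntropy H (x • A + y • B) (x • T + y • S) ≤
      x * twistedRelEntropy H A T + y * twistedRelEntropy H B S := by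
  have hAB := posDef_convexComb hA hB hx hy hxy
  have hTS := posDef_convexComb hT hS hx hy hxy
  have i1 := intervalIntegrable_quadPerspective H hA hT
  have i2 := intervalIntegrable_quadPerspective H hB hS
  have key := intervalIntegral.integral_mono_on zero_le_one
    (intervalIntegrable_quadPerspective H hAB hTS) ((i1.const_mul x).add (i2.const_mul y))
    (fun s hs => by
      have h := mul_le_mul_of_nonneg_left
        (quadPerspective_convexComb_le hs H hA hB hT hS hx hy hxy) (sub_nonneg.2 hs.2)
      refine h.trans_eq ?_
      ring)
  rw [intervalIntegral.integral_add (i1.const_mul x) (i2.const_mul y),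
    intervalIntegral.integral_const_mul, intervalIntegral.integral_const_mul] at key
  rw [twistedRelEntropy_eq_integral H hA hT, twistedRelEntropy_eq_integral H hB hS,
    twistedRelEntropy_eq_integral H hAB hTS]
  simp only [Matrix.mul_add, Matrix.add_mul, Matrix.mul_smul, Matrix.smul_mul,
    Matrix.trace_add, Matrix.trace_smul, Complex.add_re, Complex.smul_re, smul_eq_mul]
  linarith

/-- Klein's inequality. -/
theorem trace_sub_trace_le_twistedRelEntropy (H : Matrix m n ℂ) {A : Matrix m m ℂ}
    {T : Matrix n n ℂ} (hA : A.PosDef) (hT : T.PosDef) :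
    (Hᴴ * H * T).trace.re - (Hᴴ * A * H).trace.re ≤ twistedRelEntropy H A T := by
  rw [twistedRelEntropy_eq_sum H hA.1 hT.1]
  refine le_add_of_nonneg_right (Finset.sum_nonneg fun i _ => Finset.sum_nonneg fun j _ => ?_)
  refine mul_nonneg (Complex.normSq_nonneg _) ?_
  have ha := hA.eigenvalues_pos i
  have ht := hT.eigenvalues_pos j
  -- Multiplied by `t`, `log (a/t) ≤ a/t - 1` makes each summand nonnegative.
  have h := Real.log_le_sub_one_of_pos (div_pos ha ht)
  rw [Real.log_div ha.ne' ht.ne'] at h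
  have h2 := mul_le_mul_of_nonneg_left h ht.le
  have h3 : hT.1.eigenvalues j * (hA.1.eigenvalues i / hT.1.eigenvalues j - 1) =
      hA.1.eigenvalues i - hT.1.eigenvalues j := by field_simp
  linarith

end RelativeEntropy

/-! ### The Gibbs variational principle -/

section Gibbs

open scoped Matrix.Norms.L2Operator

variable {n : Type*} [Fintype n] [DecidableEq n]

theorem cfc_log_exp {K : Matrix n n ℂ} (hK : K.IsHermitian) :
    cfc Real.log (NormedSpace.exp K) = K :=
  CFC.log_exp K hK

theorem posDef_exp {K : Matrix n n ℂ} (hK : K.IsHermitian) : (NormedSpace.exp K).PosDef := by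
  rw [← CFC.real_exp_eq_normedSpace_exp (a := K) hK]
  have h : (cfc Real.exp K).PosSemidef :=
    Matrix.nonneg_iff_posSemidef.1 (cfc_nonneg fun x _ => (Real.exp_pos x).le)
  refine h.posDef_iff_isUnit.2 ?_
  rw [CFC.real_exp_eq_normedSpace_exp (a := K) hK]
  exact Matrix.isUnit_exp K

theorem cfc_mul_log_eq {T : Matrix n n ℂ} (hT : T.IsHermitian) :
    cfc (fun x => x * Real.log x) T = cfc Real.log T * T := by
  have hfin : (spectrum ℝ T).Finite := hT.spectrum_real_eq_range_eigenvalues ▸ Set.finite_range _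
  rw [show (fun x : ℝ => x * Real.log x) = fun x => Real.log x * x from funext fun x => mul_comm _ _,
    cfc_mul Real.log (fun x => x) T (hfin.continuousOn _) (hfin.continuousOn _),
    cfc_id' ℝ T hT.isSelfAdjoint]

/-- The Gibbs functional, whose maximum over `T` is `Tr exp K`. -/
noncomputable def gibbs (K T : Matrix n n ℂ) : ℝ :=
  (K * T).trace.re - (cfc (fun x => x * Real.log x) T).trace.re + T.trace.re

theorem gibbs_le {K T : Matrix n n ℂ} (hK : K.IsHermitian) (hT : T.PosDef) :
    gibbs K T ≤ (NormedSpace.exp K).trace.re := by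
  -- With `H = 1` and `A = exp K`, `log A = K`, so Klein's inequality is the Gibbs bound.
  have h := trace_sub_trace_le_twistedRelEntropy 1 (posDef_exp hK) hT
  simp only [twistedRelEntropy, cfc_log_exp hK, conjTranspose_one, Matrix.one_mul,
    Matrix.mul_one] at h
  rw [gibbs]
  linarith

theorem gibbs_exp {K : Matrix n n ℂ} (hK : K.IsHermitian) :
    gibbs K (NormedSpace.exp K) = (NormedSpace.exp K).trace.re := by
  rw [gibbs, cfc_mul_log_eq (posDef_exp hK).1, cfc_log_exp hK]
  ring

end Gibbs

/-! ### Joint concavity and partial maximization -/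

theorem lsExponent_isHermitian {k m n : ℕ} {L : Matrix (Fin n) (Fin n) ℂ} (hL : L.IsHermitian)
    (H : Fin k → Matrix (Fin m) (Fin n) ℂ) (A : Fin k → Matrix (Fin m) (Fin m) ℂ) :
    (lsExponent L H A).IsHermitian := by
  refine hL.add (isSelfAdjoint_sum _ fun i _ => ?_)
  have h : (cfc Real.log (A i)).IsHermitian := cfc_predicate Real.log (A i)
  exact isHermitian_conjTranspose_mul_mul (H i) h

/-- Since `log 1 = 0`, the `R` term only supplies the part of `Tr T log T` missing from the sum when
`∑ Hᵢ* Hᵢ ≠ 1`. -/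
theorem gibbs_lsExponent_eq {k m n : ℕ} (L : Matrix (Fin n) (Fin n) ℂ)
    (H : Fin k → Matrix (Fin m) (Fin n) ℂ) {R : Matrix (Fin n) (Fin n) ℂ}
    (hR : 1 - ∑ i, (H i)ᴴ * H i = Rᴴ * R) (A : Fin k → Matrix (Fin m) (Fin m) ℂ)
    (T : Matrix (Fin n) (Fin n) ℂ) :
    gibbs (lsExponent L H A) T = (L * T).trace.re + T.trace.re -
      ∑ i, twistedRelEntropy (H i) (A i) T - twistedRelEntropy R 1 T := by
  have hlog : cfc Real.log (1 : Matrix (Fin n) (Fin n) ℂ) = 0 := by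
    rw [cfc_apply_one]; simp
  simp only [gibbs, lsExponent, twistedRelEntropy, hlog, ← hR, Matrix.sub_mul, Matrix.add_mul,
    Matrix.sum_mul, Matrix.trace_add, Matrix.trace_sub, Matrix.trace_sum, Complex.add_re,
    Complex.sub_re, Complex.re_sum, Finset.sum_sub_distrib, Matrix.one_mul, Matrix.mul_zero,
    Matrix.zero_mul, Matrix.trace_zero, Complex.zero_re]
  ring

theorem gibbs_lsExponent_concave {k m n : ℕ} (L : Matrix (Fin n) (Fin n) ℂ)
    {H : Fin k → Matrix (Fin m) (Fin n) ℂ} (hH : ∑ i, (H i)ᴴ * H i ≤ 1)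
    {A B : Fin k → Matrix (Fin m) (Fin m) ℂ} (hA : ∀ i, (A i).PosDef) (hB : ∀ i, (B i).PosDef)
    {T S : Matrix (Fin n) (Fin n) ℂ} (hT : T.PosDef) (hS : S.PosDef) {x y : ℝ} (hx : 0 ≤ x)
    (hy : 0 ≤ y) (hxy : x + y = 1) :
    x * gibbs (lsExponent L H A) T + y * gibbs (lsExponent L H B) S ≤
      gibbs (lsExponent L H (x • A + y • B)) (x • T + y • S) := by
  obtain ⟨R, hR⟩ := CStarAlgebra.nonneg_iff_eq_star_mul_self.1 (sub_nonneg.2 hH)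
  have h1 := Finset.sum_le_sum fun i (_ : i ∈ Finset.univ) =>
    twistedRelEntropy_convexComb_le (H i) (hA i) (hB i) hT hS hx hy hxy
  have h2 := twistedRelEntropy_convexComb_le R (A := 1) (B := 1) PosDef.one PosDef.one hT hS
    hx hy hxy
  rw [← add_smul, hxy, one_smul] at h2
  rw [Finset.sum_add_distrib, ← Finset.mul_sum, ← Finset.mul_sum] at h1
  rw [gibbs_lsExponent_eq L H hR, gibbs_lsExponent_eq L H hR, gibbs_lsExponent_eq L H hR]
  simp only [Matrix.mul_add, Matrix.mul_smul, Matrix.trace_add, Matrix.trace_smul,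
    Complex.add_re, Complex.smul_re, smul_eq_mul, Pi.add_apply, Pi.smul_apply]
  linarith

theorem mainTheorem3 (k m n : ℕ) (L : Matrix (Fin n) (Fin n) ℂ) (hL : L.IsHermitian)
    (H : Fin k → Matrix (Fin m) (Fin n) ℂ) (hH : ∑ i, (H i)ᴴ * H i ≤ 1) :
    ConcaveOn ℝ {A : Fin k → Matrix (Fin m) (Fin m) ℂ | ∀ i, (A i).PosDef}
      (lsTrace L H) := by
  refine ⟨fun A hA B hB x y hx hy hxy i => posDef_convexComb (hA i) (hB i) hx hy hxy,
    fun A hA B hB x y hx hy hxy => ?_⟩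
  have hKA := lsExponent_isHermitian hL H A
  have hKB := lsExponent_isHermitian hL H B
  -- The endpoints use their optimal `T`; the combination of these is merely a competitor at the
  -- intermediate point.
  have h := gibbs_lsExponent_concave L hH hA hB (posDef_exp hKA) (posDef_exp hKB) hx hy hxy
  rw [gibbs_exp hKA, gibbs_exp hKB] at h
  exact h.trans (gibbs_le (lsExponent_isHermitian hL H _)
    (posDef_convexComb (posDef_exp hKA) (posDef_exp hKB) hx hy hxy))
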